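/- **Symplectic Ky Fan theorem for generalized means.** A *mean* is a positive continuous function $\mathbf M$ on $(0,\infty)\times(0,\infty)$ such that for all $a,b>0$: (i) $\mathbf M(a,b)=\mathbf M(b,a)$; (ii) $\mathbf M(ra,rb)=r\,\mathbf M(a,b)$ for all $r>0$; (iii) $\mathbf M(a,b)$ is monotone increasing (in the weak sense) in $a$ and in $b$; (iv) if $a\le b$, then $a\le \mathbf M(a,b)\le b$. Let $J_{2n}=\begin{bmatrix}0&I_n\\-I_n&0\end{bmatrix}$, and call a real $2n\times 2n$ matrix $W$ *symplectic* if $W^\top J_{2n}W=J_{2n}$. The *symplectic eigenvalues* of a real positive definite $2n\times 2n$ matrix $A$ are the numbers $\delta_1,\dots,\delta_n$, listed with multiplicity, such that $A=W(D\oplus D)W^\top$ with $W$ symplectic and $D=\operatorname{diag}(\delta_1,\dots,\delta_n)$; write $\delta_1^\uparrow\le\cdots\le\delta_n^\uparrow$ for their increasing rearrangement. For $k\le n$ let $$\mathcal S_k(A)=\{X^\top A X : X \text{ a real } 2n\times 2k \text{ matrix with } X^\top J_{2n}X=J_{2k}\}.$$ Let $\mathbf M$ be a mean such that $\sqrt{ab}\le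 \mathbf M(a,b)$ for all $a,b>0$, and let $A$ be a real (symmetric) positive definite $2n\times 2n$ matrix. Then $A$ has symplectic eigenvalues $\delta_1,\dots,\delta_n$ as above, and, for any such $\delta_1,\dots,\delta_n$ and every integer $k$ with $1\le k\le n$, $$\sum_{j=1}^k\delta_j^\uparrow=\min\Big\{\sum_{j=1}^k \mathbf M(b_{jj},b_{k+j,k+j}) : [b_{ij}]_{i,j=1}^{2k}\in\mathcal S_k(A)\Big\},$$ the minimum being attained. -/

import Mathlib

/-!
`2n × 2n` real matrices are indexed by `Fin n ⊕ Fin n`: the first index `j ≤ n` is `Sum.inl j`, the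
index `n + j` is `Sum.inr j`. The standard symplectic form is Mathlib's `Matrix.J`, with blocks
`[0, -I; I, 0]`. It is the negative of the form `[0, I; -I, 0]`; every condition below has the shape
`Xᵀ * J * X = J`, which does not change when both forms are negated.
-/

namespace SymplecticKyFan

/-- `M` is a (generalized) mean: a positive continuous function on `(0, ∞) × (0, ∞)` which is
symmetric, homogeneous, monotone increasing in both arguments, and lies between its arguments.
Only the values of `M` at positive arguments matter. -/
structure IsMean (M : ℝ → ℝ → ℝ) : Prop where
  pos : ∀ a b : ℝ, 0 < a → 0 < b → 0 < M a b
  continuousOn : ContinuousOn (fun p : ℝ × ℝ => M p.1 p.2) (Set.Ioi 0 ×ˢ Set.Ioi 0)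
  symm : ∀ a b : ℝ, 0 < a → 0 < b → M a b = M b a
  homogeneous : ∀ a b r : ℝ, 0 < a → 0 < b → 0 < r → M (r * a) (r * b) = r * M a b
  monotone_left : ∀ b : ℝ, 0 < b → MonotoneOn (fun a => M a b) (Set.Ioi 0)
  monotone_right : ∀ a : ℝ, 0 < a → MonotoneOn (fun b => M a b) (Set.Ioi 0)
  between : ∀ a b : ℝ, 0 < a → 0 < b → a ≤ b → a ≤ M a b ∧ M a b ≤ b

/-- `δ₁, …, δₙ` (in some order, with multiplicity) are the symplectic eigenvalues of `A`:
`A = W (D ⊕ D) Wᵀ` with `W` symplectic and `D = diag(δ₁, …, δₙ)`. -/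
def IsSymplecticEigenvalues {n : ℕ} (A : Matrix (Fin n ⊕ Fin n) (Fin n ⊕ Fin n) ℝ)
    (δ : Fin n → ℝ) : Prop :=
  ∃ W ∈ Matrix.symplecticGroup (Fin n) ℝ,
    A = W * Matrix.fromBlocks (Matrix.diagonal δ) 0 0 (Matrix.diagonal δ) * W.transpose

/-- The increasing rearrangement `z₁↑ ≤ ⋯ ≤ zₙ↑` of a real vector `z`. -/
noncomputable def increasing {n : ℕ} (z : Fin n → ℝ) : Fin n → ℝ :=
  z ∘ Tuple.sort z

/-- The set `S_k(A)` of all `Xᵀ A X`, where `X` is a real `2n × 2k` matrix with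
`Xᵀ J_{2n} X = J_{2k}`. -/
def symplecticCompressions {n : ℕ} (k : ℕ) (A : Matrix (Fin n ⊕ Fin n) (Fin n ⊕ Fin n) ℝ) :
    Set (Matrix (Fin k ⊕ Fin k) (Fin k ⊕ Fin k) ℝ) :=
  {B | ∃ X : Matrix (Fin n ⊕ Fin n) (Fin k ⊕ Fin k) ℝ,
    X.transpose * Matrix.J (Fin n) ℝ * X = Matrix.J (Fin k) ℝ ∧ B = X.transpose * A * X}

end SymplecticKyFan

/-!
*Existence of symplectic eigenvalues* (Williamson). Write `A = Bᵀ B`. The matrix `K = B J Bᵀ` is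
skew-symmetric and invertible, so there is an orthonormal basis of vectors `aⱼ, bⱼ` with
`K aⱼ = μⱼ bⱼ` and `K bⱼ = -μⱼ aⱼ` (`exists_orthonormal_pairs`): `aⱼ` is an eigenvector of the
symmetric map `K²` on the orthogonal complement of the pairs already found. If `O` is the orthogonal
matrix with these columns and `D = diag μ ⊕ diag μ`, then `W = Bᵀ O D^{-1/2}` is symplectic and
`W D Wᵀ = A`.

*Lower bound.* Multiplying the columns `xⱼ`, `x_{k+j}` of `X` by `tⱼ` and `tⱼ⁻¹` preserves
`Xᵀ J X = J`, and a suitable choice makes both `b_{jj}` and `b_{k+j,k+j}` equal to their geometric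
mean. As `M` dominates the geometric mean, it suffices to bound `tr (Xᵀ A X)` below by twice the
sum of the `k` smallest `δⱼ`, and, replacing `X` by `Wᵀ X`, one may assume `A = D`
(`trace_compression_ge`). Split `X = Y + Z` into the part `Y` commuting with `J` and the part `Z`
anticommuting with it. Then `Yᵀ Y = 1 + Zᵀ Z` and `tr (Xᵀ D X) = tr (Yᵀ D Y) + tr (Zᵀ D Z)`. Since
`Yᵀ Y ≥ 1`, the matrix `Y Yᵀ` dominates the orthogonal projection `Y (Yᵀ Y)⁻¹ Yᵀ`, whose diagonal
entries lie in `[0, 1]` and sum to `2 k` (`exists_diag_contraction`). A combination of the `δᵢ` with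
weights in `[0, 1]` of sum `k` is at least the sum of the `k` smallest `δᵢ`
(`sum_increasing_le`).

*Attainment.* The columns of `(Wᵀ)⁻¹` belonging to the `k` smallest `δⱼ` give a diagonal compression
(`diagonal_mem_symplecticCompressions`), and `M δ δ = δ`.
-/

namespace SymplecticKyFan

open Matrix

/-! ### Existence of symplectic eigenvalues -/

lemma fromBlocks_diagonal_comm_J {l : Type*} [Fintype l] [DecidableEq l] (d : l → ℝ) :
    fromBlocks (diagonal d) 0 0 (diagonal d) * J l ℝ
      = J l ℝ * fromBlocks (diagonal d) 0 0 (diagonal d) := by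
  simp [J, fromBlocks_multiply, -fromBlocks_diagonal]

open scoped InnerProductSpace in
/-- Normal form of an injective skew-symmetric map `K`: as long as the dimension allows, there are
orthonormal pairs spanning planes on each of which `K` acts as a quarter turn times a positive
scalar. -/
lemma exists_orthonormal_pairs {E : Type*} [NormedAddCommGroup E] [InnerProductSpace ℝ E]
    [FiniteDimensional ℝ E] (K : E →ₗ[ℝ] E) (hK : ∀ x y, ⟪K x, y⟫_ℝ = -⟪x, K y⟫_ℝ)
    (hinj : Function.Injective K) (m : ℕ) (hm : m + m ≤ Module.finrank ℝ E) :
    ∃ (v : Fin m ⊕ Fin m → E) (μ : Fin m → ℝ), Orthonormal ℝ v ∧ (∀ j, 0 < μ j) ∧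
      (∀ j, K (v (Sum.inl j)) = μ j • v (Sum.inr j)) ∧
      ∀ j, K (v (Sum.inr j)) = -μ j • v (Sum.inl j) := by
  induction m with
  | zero => exact ⟨fun p => p.elim Fin.elim0 Fin.elim0, Fin.elim0, by
      constructor <;> rintro (i | i) <;> exact i.elim0, fun j => j.elim0, fun j => j.elim0,
      fun j => j.elim0⟩
  | succ m ih =>
    obtain ⟨v, μ, hv, hμ, hl, hr⟩ := ih (by omega)
    -- A further pair is found in the orthogonal complement `F` of the old ones. `K` preserves `F`.
    set F := (Submodule.span ℝ (Set.range v))ᗮ with hF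
    have memF : ∀ x, x ∈ F ↔ ∀ p, ⟪v p, x⟫_ℝ = 0 := by
      intro x
      rw [hF, Submodule.mem_orthogonal]
      refine ⟨fun h p => h _ (Submodule.subset_span ⟨p, rfl⟩), fun h u hu => ?_⟩
      induction hu using Submodule.span_induction with
      | mem u hu => obtain ⟨p, rfl⟩ := hu; exact h p
      | zero => simp
      | add a b _ _ ha hb => rw [inner_add_left, ha, hb, add_zero]
      | smul c a _ ha => rw [inner_smul_left, ha, mul_zero]
    have hKF : ∀ x ∈ F, K x ∈ F := by
      intro x hx
      rw [memF] at hx ⊢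
      rintro (j | j)
      · rw [← neg_eq_zero, ← hK, hl, inner_smul_left, hx, mul_zero]
      · rw [← neg_eq_zero, ← hK, hr, inner_smul_left, hx, mul_zero]
    have hSF : ∀ x ∈ F, (K ∘ₗ K) x ∈ F := fun x hx => hKF _ (hKF x hx)
    have hS : (K ∘ₗ K).IsSymmetric := fun x y => by simp [hK]
    have hdim : 0 < Module.finrank ℝ F := by
      have h1 := Submodule.finrank_add_finrank_orthogonal (Submodule.span ℝ (Set.range v))
      have h2 : Module.finrank ℝ (Submodule.span ℝ (Set.range v)) ≤ m + m := by
        refine (finrank_range_le_card (R := ℝ) v).trans_eq ?_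
        simp
      rw [← hF] at h1
      omega
    have : Nontrivial F := Module.finrank_pos_iff.1 hdim
    obtain ⟨lam, hlamE⟩ : ∃ lam, Module.End.HasEigenvalue ((K ∘ₗ K).restrict hSF) lam :=
      ⟨_, (hS.restrict_invariant hSF).hasEigenvalue_iSup_of_finiteDimensional⟩
    obtain ⟨⟨a₀, ha₀F⟩, ha₀⟩ := hlamE.exists_hasEigenvector
    have hne : a₀ ≠ 0 := fun h => ha₀.2 (by simp [h])
    have hlam : K (K a₀) = lam • a₀ := congrArg Subtype.val ha₀.apply_eq_smul
    obtain ⟨a, haF, ha1, haK⟩ : ∃ a ∈ F, ⟪a, a⟫_ℝ = 1 ∧ K (K a) = lam • a := by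
      refine ⟨‖a₀‖⁻¹ • a₀, F.smul_mem _ ha₀F, ?_, by simp [hlam, smul_comm lam]⟩
      have : ‖a₀‖ ≠ 0 := norm_ne_zero_iff.2 hne
      rw [inner_smul_left, inner_smul_right, real_inner_self_eq_norm_sq]
      simp only [conj_trivial]
      field_simp
    have hKa : K a ≠ 0 := fun h => by
      have : a = 0 := hinj (by rw [h, map_zero])
      simp [this] at ha1
    have hν : 0 < ‖K a‖ := norm_pos_iff.2 hKa
    set ν := ‖K a‖ with hνdef
    -- `⟪K² a, a⟫ = -‖K a‖²`, so that `b = ‖K a‖⁻¹ • K a` is sent back to `-‖K a‖ • a`.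
    have hlamν : lam = -ν ^ 2 := by
      have h := hK a (K a)
      rw [haK, inner_smul_right, ha1, real_inner_self_eq_norm_sq] at h
      linarith
    set b := ν⁻¹ • K a with hb
    have hbF : b ∈ F := F.smul_mem _ (hKF a haF)
    have haKa : ⟪a, K a⟫_ℝ = 0 := by
      have h := hK a a
      rw [real_inner_comm] at h
      linarith
    have hab : ⟪a, b⟫_ℝ = 0 := by rw [hb, inner_smul_right, haKa, mul_zero]
    have hb1 : ⟪b, b⟫_ℝ = 1 := by
      rw [hb, inner_smul_left, inner_smul_right, real_inner_self_eq_norm_sq, ← hνdef]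
      simp only [conj_trivial]
      field_simp
    have hba : ⟪b, a⟫_ℝ = 0 := by rw [real_inner_comm, hab]
    have hva := (memF a).1 haF
    have hvb := (memF b).1 hbF
    have hav : ∀ p, ⟪a, v p⟫_ℝ = 0 := fun p => by rw [real_inner_comm, hva]
    have hbv : ∀ p, ⟪b, v p⟫_ℝ = 0 := fun p => by rw [real_inner_comm, hvb]
    have hKaν : K a = ν • b := by rw [hb, smul_inv_smul₀ hν.ne']
    have hKbν : K b = -ν • a := by
      rw [hb, map_smul, haK, hlamν, smul_smul]
      congr 1
      field_simp
    refine ⟨Sum.elim (Fin.cons a fun j => v (Sum.inl j)) (Fin.cons b fun j => v (Sum.inr j)),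
      Fin.cons ν μ, ?_, ?_, ?_, ?_⟩
    · rw [orthonormal_iff_ite] at hv ⊢
      rintro (i | i) (j | j) <;> refine Fin.cases ?_ (fun i => ?_) i <;>
        refine Fin.cases ?_ (fun j => ?_) j <;>
        simp [ha1, hb1, hab, hba, hva, hvb, hav, hbv, hv, -inner_self_eq_norm_sq_to_K,
          Fin.succ_ne_zero, (Fin.succ_ne_zero _).symm]
    all_goals
      intro j
      refine Fin.cases ?_ (fun j => ?_) j <;> simp [hν, hμ, hl, hr, hKaν, hKbν]

/-- **Williamson's theorem**: every real positive definite `2n × 2n` matrix has symplectic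
eigenvalues. -/
theorem exists_isSymplecticEigenvalues {n : ℕ} (A : Matrix (Fin n ⊕ Fin n) (Fin n ⊕ Fin n) ℝ)
    (hA : A.PosDef) : ∃ δ : Fin n → ℝ, IsSymplecticEigenvalues A δ := by
  obtain ⟨B, hBA⟩ : ∃ B : Matrix (Fin n ⊕ Fin n) (Fin n ⊕ Fin n) ℝ, A = Bᵀ * B := by
    open scoped MatrixOrder in
    obtain ⟨B, hB⟩ := CStarAlgebra.nonneg_iff_eq_star_mul_self.mp hA.posSemidef.nonneg
    exact ⟨B, by rw [hB, star_eq_conjTranspose, conjTranspose_eq_transpose_of_trivial]⟩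
  have hBu : IsUnit B.det := by
    have h := (Matrix.isUnit_iff_isUnit_det A).1 hA.isUnit
    rw [hBA, det_mul, det_transpose] at h
    exact isUnit_of_mul_isUnit_left h
  set K := B * J (Fin n) ℝ * Bᵀ with hK
  have hKT : Kᵀ = -K := by simp [hK, Matrix.mul_assoc]
  have hKu : IsUnit K.det := by
    rw [hK, det_mul, det_mul, det_transpose]
    exact (hBu.mul (isUnit_det_J _ _)).mul hBu
  obtain ⟨v, μ, hv, hμ, hl, hr⟩ := exists_orthonormal_pairs
    (E := EuclideanSpace ℝ (Fin n ⊕ Fin n)) (toEuclideanLin K)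
    (fun x y => by
      rw [← LinearMap.adjoint_inner_right, ← toEuclideanLin_conjTranspose_eq_adjoint,
        conjTranspose_eq_transpose_of_trivial, hKT, map_neg, LinearMap.neg_apply, inner_neg_right])
    (fun x y hxy => by
      have h := congrArg WithLp.ofLp hxy
      exact WithLp.ofLp_injective 2
        (mulVec_injective_iff_isUnit.2 ((Matrix.isUnit_iff_isUnit_det K).2 hKu) h)) n (by simp)
  set O : Matrix (Fin n ⊕ Fin n) (Fin n ⊕ Fin n) ℝ := of fun i p => v p i with hO
  have hOO : Oᵀ * O = 1 := by
    ext p q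
    have h := (orthonormal_iff_ite.1 hv) p q
    rw [Matrix.one_apply, ← h]
    simp [Matrix.mul_apply, hO, PiLp.inner_apply, mul_comm]
  have hOO' : O * Oᵀ = 1 := mul_eq_one_comm.1 hOO
  have hKO : K * O = O * (J (Fin n) ℝ * fromBlocks (diagonal μ) 0 0 (diagonal μ)) := by
    have hcol : ∀ i p, (K * O) i p = toEuclideanLin K (v p) i := fun i p => rfl
    ext i (j | j)
    · rw [hcol, hl]
      simp [J, fromBlocks_multiply, Matrix.mul_apply, hO, diagonal_apply, mul_comm,
        -fromBlocks_diagonal]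
    · rw [hcol, hr]
      simp [J, fromBlocks_multiply, Matrix.mul_apply, hO, diagonal_apply, mul_comm,
        -fromBlocks_diagonal]
  -- `S` is `D^{-1/2}`.
  set s : Fin n → ℝ := fun j => (√(μ j))⁻¹ with hs
  set S := fromBlocks (diagonal s) 0 0 (diagonal s) with hS
  set D := fromBlocks (diagonal μ) 0 0 (diagonal μ) with hD
  have hST : Sᵀ = S := by simp [hS]
  have hsμ : ∀ j, s j * μ j * s j = 1 := fun j => by
    have h1 := Real.sq_sqrt (hμ j).le
    have h2 := (Real.sqrt_pos.2 (hμ j)).ne'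
    simp only [hs]
    field_simp
    exact h1.symm
  have hSDS : S * D * S = 1 := by
    simp [hS, hD, fromBlocks_multiply, hsμ, -fromBlocks_diagonal]
  have hSJ : S * J (Fin n) ℝ = J (Fin n) ℝ * S := fromBlocks_diagonal_comm_J s
  refine ⟨μ, Bᵀ * O * S, SymplecticGroup.mem_iff'.2 ?_, ?_⟩
  · calc (Bᵀ * O * S)ᵀ * J (Fin n) ℝ * (Bᵀ * O * S) = S * (Oᵀ * (K * O)) * S := by
          simp [hK, hST, Matrix.mul_assoc]
      _ = S * J (Fin n) ℝ * D * S := by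
          rw [hKO, ← Matrix.mul_assoc Oᵀ, hOO, Matrix.one_mul]; simp only [Matrix.mul_assoc]
      _ = J (Fin n) ℝ * (S * D * S) := by rw [hSJ]; simp only [Matrix.mul_assoc]
      _ = J (Fin n) ℝ := by rw [hSDS, Matrix.mul_one]
  · calc A = Bᵀ * (O * Oᵀ) * B := by rw [hOO', Matrix.mul_one, hBA]
      _ = Bᵀ * O * (S * D * S) * Oᵀ * B := by
          rw [hSDS]; simp only [Matrix.mul_one, Matrix.mul_assoc]
      _ = Bᵀ * O * S * D * (Bᵀ * O * S)ᵀ := by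
          simp only [transpose_mul, transpose_transpose, hST, Matrix.mul_assoc]

/-! ### The trace inequality for `D ⊕ D` -/

lemma mul_transpose_diag_nonneg {ι κ : Type*} [Fintype κ] (C : Matrix ι κ ℝ) (i : ι) :
    0 ≤ (C * Cᵀ) i i := by
  rw [Matrix.mul_apply]
  exact Finset.sum_nonneg fun j _ => mul_self_nonneg _

/-- Since `Yᵀ Y ≥ 1`, the matrix `Y Yᵀ` dominates the orthogonal projection onto the column space of
`Y`. The numbers `q i` are the diagonal entries of that projection. -/
lemma exists_diag_contraction {ι κ : Type*} [Fintype ι] [Fintype κ] [DecidableEq κ]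
    (Y Z : Matrix ι κ ℝ) (hYZ : Yᵀ * Y = 1 + Zᵀ * Z) :
    ∃ q : ι → ℝ, (∀ i, 0 ≤ q i) ∧ (∀ i, q i ≤ 1) ∧ ∑ i, q i = Fintype.card κ ∧
      ∀ i, q i ≤ (Y * Yᵀ) i i := by
  have hpd : (Yᵀ * Y).PosDef := by
    rw [hYZ]
    have h := Matrix.posSemidef_conjTranspose_mul_self Z
    rw [conjTranspose_eq_transpose_of_trivial] at h
    exact PosDef.one.add_posSemidef h
  set N := Yᵀ * Y with hN
  have hu : IsUnit N.det := (Matrix.isUnit_iff_isUnit_det N).1 hpd.isUnit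
  have hNT : (N⁻¹)ᵀ = N⁻¹ := by
    rw [transpose_nonsing_inv]; simp [hN]
  set P := Y * N⁻¹ * Yᵀ with hP
  have hPT : Pᵀ = P := by
    simp [hP, hNT, Matrix.mul_assoc]
  have hPP : P * P = P := by
    calc P * P = Y * (N⁻¹ * N) * N⁻¹ * Yᵀ := by simp only [hP, hN, Matrix.mul_assoc]
      _ = P := by rw [nonsing_inv_mul _ hu, Matrix.mul_one]
  have hdiag : ∀ i, P i i = ∑ j, P i j ^ 2 := fun i => by
    conv_lhs => rw [← hPP]
    rw [Matrix.mul_apply]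
    refine Finset.sum_congr rfl fun j _ => ?_
    rw [sq]
    congr 1
    conv_lhs => rw [← hPT]
    rfl
  have hnonneg : ∀ i, 0 ≤ P i i := fun i => by
    rw [hdiag]; positivity
  refine ⟨fun i => P i i, hnonneg, fun i => ?_, ?_, fun i => ?_⟩
  -- `P` is a symmetric idempotent, hence `P i i = ∑ j, P i j ^ 2 ≥ P i i ^ 2`.
  · have h : P i i ^ 2 ≤ P i i := by
      conv_rhs => rw [hdiag]
      exact Finset.single_le_sum (f := fun j => P i j ^ 2) (fun j _ => sq_nonneg _)
        (Finset.mem_univ i)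
    nlinarith [hnonneg i]
  · change P.trace = _
    rw [hP, Matrix.mul_assoc, trace_mul_comm, Matrix.mul_assoc, ← hN, nonsing_inv_mul _ hu,
      trace_one]
  · -- `Y Yᵀ - P = C Cᵀ + (C Z) (C Z)ᵀ` with `C = Y N⁻¹ Zᵀ`, because `Zᵀ Z = N - 1`.
    have key : Y * Yᵀ = P + ((Y * N⁻¹ * Zᵀ) * (Y * N⁻¹ * Zᵀ)ᵀ +
        (Y * N⁻¹ * Zᵀ * Z) * (Y * N⁻¹ * Zᵀ * Z)ᵀ) := by
      have h1 : Zᵀ * Z = N - 1 := by rw [hYZ]; abel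
      have e1 : (Y * N⁻¹ * Zᵀ) * (Y * N⁻¹ * Zᵀ)ᵀ = Y * (N⁻¹ * (N - 1) * N⁻¹) * Yᵀ := by
        rw [← h1]; simp only [transpose_mul, transpose_transpose, hNT, Matrix.mul_assoc]
      have e2 : (Y * N⁻¹ * Zᵀ * Z) * (Y * N⁻¹ * Zᵀ * Z)ᵀ
          = Y * (N⁻¹ * (N - 1) * ((N - 1) * N⁻¹)) * Yᵀ := by
        rw [← h1]; simp only [transpose_mul, transpose_transpose, hNT, Matrix.mul_assoc]
      have l1 : N⁻¹ * (N - 1) = 1 - N⁻¹ := by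
        rw [Matrix.mul_sub, nonsing_inv_mul _ hu, Matrix.mul_one]
      have l2 : (N - 1) * N⁻¹ = 1 - N⁻¹ := by
        rw [Matrix.sub_mul, mul_nonsing_inv _ hu, Matrix.one_mul]
      rw [e1, e2, hP, l1, l2]
      simp only [Matrix.mul_one, Matrix.one_mul, Matrix.mul_sub, Matrix.sub_mul]
      abel
    rw [key]
    have a := mul_transpose_diag_nonneg (Y * N⁻¹ * Zᵀ) i
    have b := mul_transpose_diag_nonneg (Y * N⁻¹ * Zᵀ * Z) i
    simp only [Matrix.add_apply]
    linarith

/-- The bathtub principle: weights `r i ∈ [0, 1]` of total mass `k` minimize `∑ i, δ i * r i` when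
they are all put on the `k` smallest `δ i`. -/
lemma sum_increasing_le {n k : ℕ} (hk : k ≤ n) (δ r : Fin n → ℝ) (hδ : ∀ i, 0 ≤ δ i)
    (h0 : ∀ i, 0 ≤ r i) (h1 : ∀ i, r i ≤ 1) (hr : ∑ i, r i = k) :
    ∑ j : Fin k, increasing δ (Fin.castLE hk j) ≤ ∑ i, δ i * r i := by
  obtain rfl | hkpos := Nat.eq_zero_or_pos k
  · simpa using Finset.sum_nonneg fun i _ => mul_nonneg (hδ i) (h0 i)
  set σ := Tuple.sort δ
  have hmono : Monotone (increasing δ) := Tuple.monotone_sort δ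
  have hσ : ∑ i, δ i * r i = ∑ i, increasing δ i * r (σ i) :=
    (Equiv.sum_comp σ fun i => δ i * r i).symm
  have hr' : ∑ i, r (σ i) = k := by rw [Equiv.sum_comp σ r, hr]
  have hcast : ∀ f : Fin n → ℝ, ∑ j : Fin k, f (Fin.castLE hk j)
      = ∑ i : Fin n, if (i : ℕ) < k then f i else 0 := by
    intro f
    obtain ⟨m, rfl⟩ := Nat.exists_eq_add_of_le hk
    rw [Fin.sum_univ_add]
    simp [Fin.castLE, Fin.castAdd]
  -- After subtracting the `k`-th smallest value `c`, the inequality holds term by term.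
  let last : Fin n := ⟨k - 1, by omega⟩
  set c := increasing δ last with hc
  have hterm : ∑ i : Fin n, (if (i : ℕ) < k then increasing δ i - c else 0)
      ≤ ∑ i, (increasing δ i - c) * r (σ i) := by
    refine Finset.sum_le_sum fun i _ => ?_
    split_ifs with hi
    · have : increasing δ i ≤ c := hmono (show (i : ℕ) ≤ k - 1 by omega)
      nlinarith [h1 (σ i)]
    · have : c ≤ increasing δ i := hmono (show k - 1 ≤ (i : ℕ) by omega)
      exact mul_nonneg (by linarith) (h0 _)
  rw [← hcast fun i => increasing δ i - c] at hterm
  simp only [Finset.sum_sub_distrib, sub_mul, ← Finset.mul_sum, hr', Finset.sum_const,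
    Finset.card_univ, Fintype.card_fin, nsmul_eq_mul] at hterm
  rw [hσ]
  linarith

/-- The lower bound for the trace of a symplectic compression of `D ⊕ D`. The factor `2` appears
because each `δ i` occurs twice in `D ⊕ D`. -/
lemma trace_compression_ge {n k : ℕ} (hk : k ≤ n) (δ : Fin n → ℝ) (hδ : ∀ i, 0 ≤ δ i)
    (X : Matrix (Fin n ⊕ Fin n) (Fin k ⊕ Fin k) ℝ) (hX : Xᵀ * J (Fin n) ℝ * X = J (Fin k) ℝ) :
    2 * ∑ j : Fin k, increasing δ (Fin.castLE hk j)
      ≤ (Xᵀ * fromBlocks (diagonal δ) 0 0 (diagonal δ) * X).trace := by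
  set D := fromBlocks (diagonal δ) 0 0 (diagonal δ) with hD
  set Jn := J (Fin n) ℝ with hJn
  set Jk := J (Fin k) ℝ with hJk
  have hJnT : Jnᵀ = -Jn := J_transpose _ _
  have hJkT : Jkᵀ = -Jk := J_transpose _ _
  have hJn2 : Jn * Jn = -1 := J_squared _ _
  have hJk2 : Jk * Jk = -1 := J_squared _ _
  have hDJ : D * Jn = Jn * D := fromBlocks_diagonal_comm_J δ
  -- `Y` and `Z` are the parts of `X` with `Jn * Y = Y * Jk` and `Jn * Z = -(Z * Jk)`.
  set V := Jn * X * Jk with hV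
  set Y : Matrix (Fin n ⊕ Fin n) (Fin k ⊕ Fin k) ℝ := (1 / 2 : ℝ) • (X - V) with hY
  set Z : Matrix (Fin n ⊕ Fin n) (Fin k ⊕ Fin k) ℝ := (1 / 2 : ℝ) • (X + V) with hZ
  have hVT : Vᵀ = Jk * Xᵀ * Jn := by
    simp [hV, hJnT, hJkT, Matrix.mul_assoc]
  have hXV : Xᵀ * V = -1 := by
    rw [hV, ← Matrix.mul_assoc, ← Matrix.mul_assoc, hX, hJk2]
  have hVX : Vᵀ * X = -1 := by
    rw [hVT, Matrix.mul_assoc, Matrix.mul_assoc, ← Matrix.mul_assoc Xᵀ, hX, hJk2]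
  have hYZ : Yᵀ * Y = 1 + Zᵀ * Z := by
    simp only [hY, hZ, transpose_smul, transpose_sub, transpose_add, Matrix.smul_mul,
      Matrix.mul_smul, Matrix.sub_mul, Matrix.mul_sub, Matrix.add_mul, Matrix.mul_add, hXV, hVX]
    module
  have hVV : V * Vᵀ = -(Jn * (X * Xᵀ) * Jn) := by
    calc V * Vᵀ = Jn * X * (Jk * Jk) * Xᵀ * Jn := by rw [hVT, hV]; simp only [Matrix.mul_assoc]
      _ = _ := by rw [hJk2]; simp [Matrix.mul_assoc]
  have htrV : (D * (V * Vᵀ)).trace = (D * (X * Xᵀ)).trace := by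
    rw [hVV, Matrix.mul_neg, trace_neg, ← Matrix.mul_assoc, trace_mul_comm, ← Matrix.mul_assoc,
      ← Matrix.mul_assoc, ← hDJ, Matrix.mul_assoc D, hJn2]
    simp
  have htr : (D * (Y * Yᵀ)).trace + (D * (Z * Zᵀ)).trace = (D * (X * Xᵀ)).trace := by
    have h : Y * Yᵀ + Z * Zᵀ = (1 / 2 : ℝ) • (X * Xᵀ + V * Vᵀ) := by
      simp only [hY, hZ, transpose_smul, transpose_sub, transpose_add, Matrix.smul_mul,
        Matrix.mul_smul, Matrix.sub_mul, Matrix.mul_sub, Matrix.add_mul, Matrix.mul_add]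
      module
    rw [← trace_add, ← Matrix.mul_add, h, Matrix.mul_smul, Matrix.mul_add, trace_smul, trace_add,
      htrV, smul_eq_mul]
    ring
  have htrD : ∀ G : Matrix (Fin n ⊕ Fin n) (Fin n ⊕ Fin n) ℝ, (D * G).trace
      = ∑ i, δ i * (G (Sum.inl i) (Sum.inl i) + G (Sum.inr i) (Sum.inr i)) := by
    intro G
    rw [hD, fromBlocks_diagonal]
    simp [trace, Matrix.diagonal_mul, mul_add, Finset.sum_add_distrib]
  have hZnn : 0 ≤ (D * (Z * Zᵀ)).trace := by
    have hz := mul_transpose_diag_nonneg Z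
    rw [htrD]
    exact Finset.sum_nonneg fun i _ => mul_nonneg (hδ i) (add_nonneg (hz _) (hz _))
  obtain ⟨q, hq0, hq1, hqs, hqY⟩ := exists_diag_contraction Y Z hYZ
  have hsum := sum_increasing_le hk δ (fun i => (q (Sum.inl i) + q (Sum.inr i)) / 2) hδ
    (fun i => by linarith [hq0 (Sum.inl i), hq0 (Sum.inr i)])
    (fun i => by linarith [hq1 (Sum.inl i), hq1 (Sum.inr i)])
    (by
      rw [← Finset.sum_div, Finset.sum_add_distrib, ← Fintype.sum_sum_type, hqs]
      simp)
  calc 2 * ∑ j : Fin k, increasing δ (Fin.castLE hk j)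
      ≤ 2 * ∑ i, δ i * ((q (Sum.inl i) + q (Sum.inr i)) / 2) := by linarith
    _ = ∑ i, δ i * (q (Sum.inl i) + q (Sum.inr i)) := by
      rw [Finset.mul_sum]; exact Finset.sum_congr rfl fun i _ => by ring
    _ ≤ (D * (Y * Yᵀ)).trace := by
      rw [htrD]
      exact Finset.sum_le_sum fun i _ =>
        mul_le_mul_of_nonneg_left (add_le_add (hqY _) (hqY _)) (hδ i)
    _ ≤ (D * (X * Xᵀ)).trace := by linarith
    _ = (Xᵀ * D * X).trace := by
      rw [← Matrix.mul_assoc, trace_mul_comm, Matrix.mul_assoc]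

/-! ### Compressions of a positive definite matrix -/

lemma IsSymplecticEigenvalues.pos {n : ℕ} {A : Matrix (Fin n ⊕ Fin n) (Fin n ⊕ Fin n) ℝ}
    (hA : A.PosDef) {δ : Fin n → ℝ} (hδ : IsSymplecticEigenvalues A δ) (i : Fin n) : 0 < δ i := by
  obtain ⟨W, hW, rfl⟩ := hδ
  have hWu : IsUnit W := (Matrix.isUnit_iff_isUnit_det W).2 (SymplecticGroup.symplectic_det hW)
  rw [← conjTranspose_eq_transpose_of_trivial, ← star_eq_conjTranspose,
    IsUnit.posDef_star_right_conjugate_iff hWu, fromBlocks_diagonal, posDef_diagonal_iff] at hA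
  exact hA (Sum.inl i)

lemma mul_symplectic {n k : ℕ} {W : Matrix (Fin n ⊕ Fin n) (Fin n ⊕ Fin n) ℝ}
    (hW : Wᵀ * J (Fin n) ℝ * W = J (Fin n) ℝ) {X : Matrix (Fin n ⊕ Fin n) (Fin k ⊕ Fin k) ℝ}
    (hX : Xᵀ * J (Fin n) ℝ * X = J (Fin k) ℝ) :
    (W * X)ᵀ * J (Fin n) ℝ * (W * X) = J (Fin k) ℝ := by
  calc (W * X)ᵀ * J (Fin n) ℝ * (W * X) = Xᵀ * (Wᵀ * J (Fin n) ℝ * W) * X := by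
        simp only [transpose_mul, Matrix.mul_assoc]
    _ = J (Fin k) ℝ := by rw [hW, hX]

lemma trace_ge_of_mem_symplecticCompressions {n k : ℕ} (hk : k ≤ n)
    {A : Matrix (Fin n ⊕ Fin n) (Fin n ⊕ Fin n) ℝ} (hA : A.PosDef) {δ : Fin n → ℝ}
    (hδ : IsSymplecticEigenvalues A δ) {B : Matrix (Fin k ⊕ Fin k) (Fin k ⊕ Fin k) ℝ}
    (hB : B ∈ symplecticCompressions k A) :
    2 * ∑ j : Fin k, increasing δ (Fin.castLE hk j) ≤ B.trace := by
  have hpos := hδ.pos hA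
  obtain ⟨W, hW, rfl⟩ := hδ
  obtain ⟨X, hX, rfl⟩ := hB
  have hW' : Wᵀᵀ * J (Fin n) ℝ * Wᵀ = J (Fin n) ℝ := by
    rw [transpose_transpose]; exact SymplecticGroup.mem_iff.1 hW
  have h := trace_compression_ge hk δ (fun i => (hpos i).le) (Wᵀ * X) (mul_symplectic hW' hX)
  rw [transpose_mul, transpose_transpose] at h
  simpa only [Matrix.mul_assoc] using h

/-- Rescaling the columns `xⱼ` and `x_{k+j}` of `X` by `tⱼ` and `tⱼ⁻¹` preserves `Xᵀ J X = J`. -/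
lemma scaling_mem_symplecticCompressions {n k : ℕ}
    {A : Matrix (Fin n ⊕ Fin n) (Fin n ⊕ Fin n) ℝ} {B : Matrix (Fin k ⊕ Fin k) (Fin k ⊕ Fin k) ℝ}
    (hB : B ∈ symplecticCompressions k A) {t : Fin k → ℝ} (ht : ∀ j, t j ≠ 0) :
    diagonal (Sum.elim t t⁻¹) * B * diagonal (Sum.elim t t⁻¹) ∈ symplecticCompressions k A := by
  obtain ⟨X, hX, rfl⟩ := hB
  set T := diagonal (Sum.elim t t⁻¹) with hT
  have hTT : Tᵀ = T := diagonal_transpose _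
  have hTJ : T * J (Fin k) ℝ * T = J (Fin k) ℝ := by
    ext (i | i) (j | j) <;> rw [hT, mul_diagonal, diagonal_mul] <;>
      by_cases h : i = j <;> simp [J, h, ht]
  refine ⟨X * T, ?_, ?_⟩
  · calc (X * T)ᵀ * J (Fin n) ℝ * (X * T) = T * (Xᵀ * J (Fin n) ℝ * X) * T := by
          simp only [transpose_mul, hTT, Matrix.mul_assoc]
      _ = J (Fin k) ℝ := by rw [hX, hTJ]
  · simp only [transpose_mul, hTT, Matrix.mul_assoc]

lemma posDef_of_mem_symplecticCompressions {n k : ℕ}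
    {A : Matrix (Fin n ⊕ Fin n) (Fin n ⊕ Fin n) ℝ} (hA : A.PosDef)
    {B : Matrix (Fin k ⊕ Fin k) (Fin k ⊕ Fin k) ℝ} (hB : B ∈ symplecticCompressions k A) :
    B.PosDef := by
  obtain ⟨X, hX, rfl⟩ := hB
  have hinj : Function.Injective X.mulVec := by
    have hleft : (-J (Fin k) ℝ * (Xᵀ * J (Fin n) ℝ)) * X = 1 := by
      rw [Matrix.mul_assoc, hX, Matrix.neg_mul, J_squared, neg_neg]
    intro x y hxy
    have h := congrArg (-J (Fin k) ℝ * (Xᵀ * J (Fin n) ℝ)).mulVec hxy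
    simpa only [mulVec_mulVec, hleft, one_mulVec] using h
  rw [← conjTranspose_eq_transpose_of_trivial]
  exact hA.conjTranspose_mul_mul_same hinj

/-- The lower bound for the geometric mean, obtained from the trace bound by rescaling columns. -/
lemma sum_increasing_le_sum_sqrt {n k : ℕ} (hk : k ≤ n)
    {A : Matrix (Fin n ⊕ Fin n) (Fin n ⊕ Fin n) ℝ} (hA : A.PosDef) {δ : Fin n → ℝ}
    (hδ : IsSymplecticEigenvalues A δ) {B : Matrix (Fin k ⊕ Fin k) (Fin k ⊕ Fin k) ℝ}
    (hB : B ∈ symplecticCompressions k A) :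
    ∑ j : Fin k, increasing δ (Fin.castLE hk j)
      ≤ ∑ j, √(B (Sum.inl j) (Sum.inl j) * B (Sum.inr j) (Sum.inr j)) := by
  have hBpos : ∀ p, 0 < B p p := fun p => (posDef_of_mem_symplecticCompressions hA hB).diag_pos
  set a : Fin k → ℝ := fun j => √(B (Sum.inl j) (Sum.inl j)) with ha
  set b : Fin k → ℝ := fun j => √(B (Sum.inr j) (Sum.inr j)) with hb
  have ha0 : ∀ j, 0 < a j := fun j => Real.sqrt_pos.2 (hBpos _)
  have hb0 : ∀ j, 0 < b j := fun j => Real.sqrt_pos.2 (hBpos _)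
  have ha2 : ∀ j, B (Sum.inl j) (Sum.inl j) = a j ^ 2 := fun j => (Real.sq_sqrt (hBpos _).le).symm
  have hb2 : ∀ j, B (Sum.inr j) (Sum.inr j) = b j ^ 2 := fun j => (Real.sq_sqrt (hBpos _).le).symm
  -- `tⱼ² b_{jj} = tⱼ⁻² b_{k+j,k+j}` holds for `tⱼ² = √b_{k+j,k+j} / √b_{jj}`.
  set t : Fin k → ℝ := fun j => √(b j / a j) with ht
  have ht0 : ∀ j, 0 < t j := fun j => Real.sqrt_pos.2 (div_pos (hb0 j) (ha0 j))
  have ht2 : ∀ j, t j ^ 2 = b j / a j := fun j => Real.sq_sqrt (div_pos (hb0 j) (ha0 j)).le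
  have h := trace_ge_of_mem_symplecticCompressions hk hA hδ
    (scaling_mem_symplecticCompressions hB fun j => (ht0 j).ne')
  have htr : (diagonal (Sum.elim t t⁻¹) * B * diagonal (Sum.elim t t⁻¹)).trace
      = 2 * ∑ j, a j * b j := by
    rw [Matrix.trace, Fintype.sum_sum_type, Finset.mul_sum, ← Finset.sum_add_distrib]
    refine Finset.sum_congr rfl fun j _ => ?_
    simp only [diag_apply, mul_diagonal, diagonal_mul, Sum.elim_inl, Sum.elim_inr, Pi.inv_apply,
      ha2, hb2]
    have e1 : t j * a j ^ 2 * t j = a j * b j := by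
      have := (ha0 j).ne'
      calc t j * a j ^ 2 * t j = t j ^ 2 * a j ^ 2 := by ring
        _ = a j * b j := by rw [ht2]; field_simp
    have e2 : (t j)⁻¹ * b j ^ 2 * (t j)⁻¹ = a j * b j := by
      have := (ha0 j).ne'
      have := (hb0 j).ne'
      calc (t j)⁻¹ * b j ^ 2 * (t j)⁻¹ = (t j ^ 2)⁻¹ * b j ^ 2 := by ring
        _ = a j * b j := by rw [ht2]; field_simp
    rw [e1, e2]
    ring
  have hsqrt : ∀ j, √(B (Sum.inl j) (Sum.inl j) * B (Sum.inr j) (Sum.inr j)) = a j * b j :=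
    fun j => Real.sqrt_mul (hBpos _).le _
  simp only [hsqrt]
  linarith

/-- Any choice `e` of `k` of the symplectic eigenvalues is realized by a diagonal compression, whose
`X` consists of the corresponding columns of `(Wᵀ)⁻¹`. -/
lemma diagonal_mem_symplecticCompressions {n k : ℕ}
    {A : Matrix (Fin n ⊕ Fin n) (Fin n ⊕ Fin n) ℝ} {δ : Fin n → ℝ}
    (hδ : IsSymplecticEigenvalues A δ) (e : Fin k ↪ Fin n) :
    fromBlocks (diagonal (δ ∘ e)) 0 0 (diagonal (δ ∘ e)) ∈ symplecticCompressions k A := by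
  obtain ⟨W, hW, rfl⟩ := hδ
  have hWT : IsUnit (Wᵀ).det := SymplecticGroup.symplectic_det (SymplecticGroup.transpose_mem hW)
  have hWu : IsUnit W.det := SymplecticGroup.symplectic_det hW
  -- `E` selects the columns `e j` and `n + e j`.
  set E : Matrix (Fin n ⊕ Fin n) (Fin k ⊕ Fin k) ℝ :=
    (1 : Matrix (Fin n ⊕ Fin n) (Fin n ⊕ Fin n) ℝ).submatrix id (Sum.map e e) with hE
  have hsub : ∀ G : Matrix (Fin n ⊕ Fin n) (Fin n ⊕ Fin n) ℝ,
      Eᵀ * G * E = G.submatrix (Sum.map e e) (Sum.map e e) := fun G => by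
    ext p q
    simp [hE, Matrix.mul_apply, Matrix.one_apply]
  have hEJ : Eᵀ * J (Fin n) ℝ * E = J (Fin k) ℝ := by
    rw [hsub]
    ext (i | i) (j | j) <;> simp [J, Matrix.one_apply]
  have hV : ((Wᵀ)⁻¹)ᵀ * J (Fin n) ℝ * (Wᵀ)⁻¹ = J (Fin n) ℝ := by
    rw [transpose_nonsing_inv, transpose_transpose]
    conv_lhs => rw [← SymplecticGroup.mem_iff.1 hW]
    rw [Matrix.mul_assoc W, nonsing_inv_mul_cancel_left _ _ hWu,
      mul_nonsing_inv_cancel_right _ _ hWT]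
  refine ⟨(Wᵀ)⁻¹ * E, mul_symplectic hV hEJ, ?_⟩
  set D := fromBlocks (diagonal δ) 0 0 (diagonal δ) with hD
  have h : ((Wᵀ)⁻¹ * E)ᵀ * (W * D * Wᵀ) * ((Wᵀ)⁻¹ * E) = Eᵀ * D * E := by
    calc _ = Eᵀ * (W⁻¹ * (W * (D * (Wᵀ * ((Wᵀ)⁻¹ * E))))) := by
          rw [transpose_mul, transpose_nonsing_inv, transpose_transpose]
          simp only [Matrix.mul_assoc]
      _ = Eᵀ * D * E := by
          rw [nonsing_inv_mul_cancel_left _ _ hWu, mul_nonsing_inv_cancel_left _ _ hWT,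
            Matrix.mul_assoc]
  rw [h, hsub, hD]
  ext (i | i) (j | j) <;> simp [diagonal_apply, -fromBlocks_diagonal]

end SymplecticKyFan

theorem mainTheorem4 (M : ℝ → ℝ → ℝ) (hM : SymplecticKyFan.IsMean M)
    (hgeom : ∀ a b : ℝ, 0 < a → 0 < b → Real.sqrt (a * b) ≤ M a b)
    (n : ℕ) (A : Matrix (Fin n ⊕ Fin n) (Fin n ⊕ Fin n) ℝ) (hA : A.PosDef) :
    (∃ δ : Fin n → ℝ, SymplecticKyFan.IsSymplecticEigenvalues A δ) ∧
    ∀ δ : Fin n → ℝ, SymplecticKyFan.IsSymplecticEigenvalues A δ →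
      ∀ (k : ℕ) (hk : k ≤ n),
        IsLeast
          {s : ℝ | ∃ B ∈ SymplecticKyFan.symplecticCompressions k A,
            s = ∑ j : Fin k, M (B (Sum.inl j) (Sum.inl j)) (B (Sum.inr j) (Sum.inr j))}
          (∑ j : Fin k, SymplecticKyFan.increasing δ (Fin.castLE hk j)) := by
  refine ⟨SymplecticKyFan.exists_isSymplecticEigenvalues A hA, fun δ hδ k hk => ⟨?_, ?_⟩⟩
  · refine ⟨_, SymplecticKyFan.diagonal_mem_symplecticCompressions hδ
      ((Fin.castLEEmb hk).trans (Tuple.sort δ).toEmbedding), Finset.sum_congr rfl fun j _ => ?_⟩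
    have hpos := hδ.pos hA (Tuple.sort δ (Fin.castLE hk j))
    obtain ⟨h₁, h₂⟩ := hM.between _ _ hpos hpos le_rfl
    simpa [SymplecticKyFan.increasing] using le_antisymm h₁ h₂
  · rintro _ ⟨B, hB, rfl⟩
    have hBpos := SymplecticKyFan.posDef_of_mem_symplecticCompressions hA hB
    exact (SymplecticKyFan.sum_increasing_le_sum_sqrt hk hA hδ hB).trans
      (Finset.sum_le_sum fun j _ => hgeom _ _ hBpos.diag_pos hBpos.diag_pos)
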